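/- Let $p$ be a prime number. If $p \equiv 1, 65$ or $81 \pmod{112}$, then $p$ is representable (by integers $x, y$) by both or by neither of the quadratic forms $x^2+56y^2$ and $x^2+448y^2$. If $p \equiv 9, 25$ or $57 \pmod{112}$, then $p$ is representable by exactly one of these two forms. -/

import Mathlib

/-- The integer `m` is represented by the binary quadratic form `x² + n y²`, with `x`, `y`
integers. -/
def IsRepresentedBy (n m : ℤ) : Prop :=
  ∃ x y : ℤ, m = x ^ 2 + n * y ^ 2

/-!
Let `p ≡ 1 (mod 8)` be a prime that is a square modulo `7`. Thue's lemma yields `p = a² + 112c²`,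
and also `p = x² + 56y²` or `p = 2x² + 7y²`. Comparing the first representation with the second or
third one produces a factorization of a value of `r² - 2s²`, whose odd factors are `±1` modulo `8`
because `2` is a square modulo all their prime divisors of odd multiplicity. This forces `c` to be
even exactly when `p ≡ 1 (mod 16)` if `p = x² + 56y²`, and exactly when `p ≡ 9 (mod 16)` if
`p = 2x² + 7y²`. On the other hand `p` is of the form `x² + 448y²` exactly when `c` is even.
-/

open scoped NumberTheorySymbols

section Squares

theorem even_iff_sq_emod_two {x : ℤ} : Even x ↔ x ^ 2 % 2 = 0 := by
  rw [← Int.even_iff, Int.even_pow' two_ne_zero]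

theorem odd_iff_sq_emod_two {x : ℤ} : Odd x ↔ x ^ 2 % 2 = 1 := by
  rw [← Int.odd_iff, Int.odd_pow' two_ne_zero]

theorem sq_emod_four_of_even {x : ℤ} (hx : Even x) : x ^ 2 % 4 = 0 :=
  Int.emod_eq_zero_of_dvd (pow_dvd_pow_of_dvd hx.two_dvd 2)

theorem sq_emod_eight_of_odd {x : ℤ} (hx : Odd x) : x ^ 2 % 8 = 1 := by
  have := Int.eight_dvd_sq_sub_one_of_odd hx
  omega

theorem sq_emod_sixteen_eq_one_iff {x : ℤ} : x ^ 2 % 16 = 1 ↔ x % 8 = 1 ∨ x % 8 = 7 := by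
  have hsq : x ^ 2 % 16 = (x % 16) ^ 2 % 16 := by rw [pow_two, pow_two, Int.mul_emod]
  have hlt : x % 16 < 16 := Int.emod_lt_of_pos x (by norm_num)
  have hnonneg : 0 ≤ x % 16 := Int.emod_nonneg x (by norm_num)
  have hmod : x % 8 = x % 16 % 8 := by omega
  rw [hsq, hmod]
  generalize x % 16 = r at hlt hnonneg
  interval_cases r <;> decide

theorem isSquare_of_isSquare_mul_right {F : Type*} [Field F] {a b : F} (hb₀ : b ≠ 0)
    (hb : IsSquare b) (hab : IsSquare (a * b)) : IsSquare a := by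
  simpa [hb₀] using hab.div hb

theorem isUnit_of_dvd_of_squarefree_eq {R : Type*} [CommSemiring R] {n a b x y k : R}
    (hn : Squarefree n) (h : n = a * x ^ 2 + b * y ^ 2) (hx : k ∣ x) (hy : k ∣ y) : IsUnit k := by
  refine hn k ?_
  rw [h, ← pow_two]
  exact dvd_add ((pow_dvd_pow_of_dvd hx 2).mul_left a) ((pow_dvd_pow_of_dvd hy 2).mul_left b)

theorem exists_eq_add_mul_and_sq_eq {q x a : ℤ} (hq : Prime q) (hqodd : Odd q)
    (hparity : Even (x - a)) (hdvd : q ∣ x ^ 2 - a ^ 2) :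
    ∃ s t : ℤ, x = s + q * t ∧ a ^ 2 = (s - q * t) ^ 2 := by
  wlog h : q ∣ x - a generalizing a
  · have hsum : q ∣ x + a :=
      (hq.dvd_or_dvd (by rwa [sq_sub_sq] at hdvd)).resolve_right h
    simpa using this (a := -a) (by grind) (by simpa using hdvd) (by simpa using hsum)
  obtain ⟨t, ht⟩ : 2 * q ∣ x - a :=
    (Int.isCoprime_two_left.mpr hqodd).mul_dvd hparity.two_dvd h
  exact ⟨x - q * t, t, by ring, by rw [show a = x - 2 * q * t by linear_combination -ht]; ring⟩

end Squares

section QuadraticCharacter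

theorem jacobiSym_eq_one_of_dvd_sq_sub_mul_sq {d r s : ℤ} {n : ℕ} (hdn : IsCoprime d n)
    (hrs : IsCoprime r s) (h : (n : ℤ) ∣ r ^ 2 - d * s ^ 2) : J(d | n) = 1 := by
  have hsn : IsCoprime s n := by
    have hr : IsCoprime (r ^ 2 - d * s ^ 2) s := by
      rw [show r ^ 2 - d * s ^ 2 = r ^ 2 + s * (-(d * s)) by ring]
      exact IsCoprime.add_mul_left_left_iff.mpr hrs.pow_left
    exact (hr.of_isCoprime_of_dvd_left h).symm
  have hsq : J(d | n) = J(r | n) ^ 2 := by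
    rw [← jacobiSym.pow_left, ← jacobiSym.mod_left' (Int.modEq_iff_dvd.mpr h), jacobiSym.mul_left,
      jacobiSym.sq_one' (Int.isCoprime_iff_gcd_eq_one.mp hsn), mul_one]
  rcases jacobiSym.eq_one_or_neg_one (Int.isCoprime_iff_gcd_eq_one.mp hdn) with hd | hd
  · exact hd
  · linarith [sq_nonneg J(r | n)]

theorem exists_eq_mul_isCoprime (a b : ℤ) :
    ∃ g a' b' : ℤ, a = g * a' ∧ b = g * b' ∧ IsCoprime a' b' := by
  obtain ⟨a', b', ha, hb, hcop⟩ := extract_gcd a b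
  exact ⟨gcd a b, a', b', ha, hb, (gcd_isUnit_iff a' b').mp hcop⟩

theorem exists_eq_sq_mul_and_dvd_sq_sub_mul_sq {d n m r s : ℤ} (hn : n ≠ 0)
    (h : n * m = r ^ 2 - d * s ^ 2)
    (hprim : ∀ k : ℤ, k ∣ n → k ∣ m → k ∣ r → k ∣ s → IsUnit k) :
    ∃ g n' r' s' : ℤ, n = g ^ 2 * n' ∧ IsCoprime r' s' ∧ n' ∣ r' ^ 2 - d * s' ^ 2 := by
  obtain ⟨e, r', s', rfl, rfl, hrs⟩ := exists_eq_mul_isCoprime r s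
  obtain ⟨g, n₁, e', rfl, rfl, hne⟩ := exists_eq_mul_isCoprime n e
  have hg : g ≠ 0 := left_ne_zero_of_mul hn
  have hcancel : n₁ * m = g * (e' ^ 2 * (r' ^ 2 - d * s' ^ 2)) :=
    mul_left_cancel₀ hg (by linear_combination h)
  have hgm : IsCoprime g m := IsRelPrime.isCoprime fun k hkg hkm =>
    hprim k (hkg.mul_right n₁) hkm ((hkg.mul_right e').mul_right r')
      ((hkg.mul_right e').mul_right s')
  obtain ⟨n', rfl⟩ : g ∣ n₁ := hgm.dvd_of_dvd_mul_right ⟨_, hcancel⟩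
  have hn'e : IsCoprime n' (e' ^ 2) := (hne.of_isCoprime_of_dvd_left (dvd_mul_left n' g)).pow_right
  refine ⟨g, n', r', s', by ring, hrs, hn'e.dvd_of_dvd_mul_left ⟨m, ?_⟩⟩
  exact mul_left_cancel₀ hg (by linear_combination -hcancel)

theorem jacobiSym_natAbs_eq_one_of_mul_eq_sq_sub_mul_sq {d n m r s : ℤ} (hdn : IsCoprime d n)
    (h : n * m = r ^ 2 - d * s ^ 2)
    (hprim : ∀ k : ℤ, k ∣ n → k ∣ m → k ∣ r → k ∣ s → IsUnit k) : J(d | n.natAbs) = 1 := by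
  rcases eq_or_ne n 0 with rfl | hn
  · exact jacobiSym.zero_right d
  obtain ⟨g, n', r', s', rfl, hrs, hdvd⟩ := exists_eq_sq_mul_and_dvd_sq_sub_mul_sq hn h hprim
  have hdg : J(d | g.natAbs) ^ 2 = 1 := by
    have hdg : IsCoprime d g :=
      hdn.of_mul_right_left.of_isCoprime_of_dvd_right (dvd_pow_self g two_ne_zero)
    exact jacobiSym.sq_one (Int.isCoprime_iff_gcd_eq_one.mp (by simpa using hdg.abs_right))
  have hdn' : J(d | n'.natAbs) = 1 :=
    jacobiSym_eq_one_of_dvd_sq_sub_mul_sq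
      (by simpa using hdn.of_mul_right_right.abs_right) hrs
      (Int.natAbs_dvd.mpr hdvd)
  have hg : (g ^ 2).natAbs ≠ 0 := by simpa using left_ne_zero_of_mul hn
  have hn' : n'.natAbs ≠ 0 := by simpa using right_ne_zero_of_mul hn
  rw [Int.natAbs_mul, jacobiSym.mul_right' d hg hn', Int.natAbs_pow, jacobiSym.pow_right, hdg, hdn',
    one_mul]

theorem emod_eight_of_mul_eq_sq_sub_two_mul_sq {n m r s : ℤ} (hn : Odd n)
    (h : n * m = r ^ 2 - 2 * s ^ 2)
    (hprim : ∀ k : ℤ, k ∣ n → k ∣ m → k ∣ r → k ∣ s → IsUnit k) : n % 8 = 1 ∨ n % 8 = 7 := by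
  have hχ : ZMod.χ₈ n.natAbs = 1 := by
    rw [← jacobiSym.at_two (Int.natAbs_odd.mpr hn)]
    exact jacobiSym_natAbs_eq_one_of_mul_eq_sq_sub_mul_sq (Int.isCoprime_two_left.mpr hn) h hprim
  rw [ZMod.χ₈_nat_eq_if_mod_eight] at hχ
  split_ifs at hχ <;> omega

theorem legendreSym_neg_eq_of_mod_four_eq_three {p q : ℕ} [Fact p.Prime] [Fact q.Prime]
    (hp : p ≠ 2) (hq : q % 4 = 3) : legendreSym p (-q) = legendreSym q p := by
  have hq2 : q ≠ 2 := by rintro rfl; omega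
  have hpodd : p % 2 = 1 := (Fact.out : p.Prime).mod_two_eq_one_iff_ne_two.mpr hp
  have hhalf : Odd (q / 2) := by rw [Nat.odd_iff]; omega
  have hsign : legendreSym p (-1) = (-1) ^ (p / 2) := by
    rw [legendreSym.at_neg_one hp, ZMod.χ₄_eq_neg_one_pow hpodd]
  rw [neg_eq_neg_one_mul, legendreSym.mul, hsign, legendreSym.quadratic_reciprocity' hq2 hp,
    mul_comm (q / 2), pow_mul', hhalf.neg_one_pow, ← mul_assoc, ← mul_pow]
  norm_num

theorem isSquare_neg_natCast_of_isSquare_natCast {p q : ℕ} [Fact p.Prime] [Fact q.Prime]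
    (hp : p ≠ 2) (hq : q % 4 = 3) (h : IsSquare (p : ZMod q)) : IsSquare (-q : ZMod p) := by
  rcases eq_or_ne (q : ZMod p) 0 with hq₀ | hq₀
  · simp [hq₀]
  have hpq : p ≠ q := by rintro rfl; simp at hq₀
  have hp₀ : (p : ZMod q) ≠ 0 := ZMod.prime_ne_zero q p hpq.symm
  have hsymm := legendreSym_neg_eq_of_mod_four_eq_three (p := p) hp hq
  rw [(legendreSym.eq_one_iff' q hp₀).mpr h, legendreSym.eq_one_iff p (by simpa using hq₀)] at hsymm
  simpa using hsymm

end QuadraticCharacter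

section Representations

theorem exists_intCast_eq_mul_intCast {n : ℕ} (hn : ¬ IsSquare n) (l : ZMod n) :
    ∃ x y : ℤ, (x ≠ 0 ∨ y ≠ 0) ∧ x ^ 2 < n ∧ y ^ 2 < n ∧ (x : ZMod n) = l * y := by
  have : NeZero n := ⟨by rintro rfl; exact hn (IsSquare.zero)⟩
  set s := n.sqrt
  let f : Fin (s + 1) × Fin (s + 1) → ZMod n := fun u => (u.1 : ℕ) - l * (u.2 : ℕ)
  have hcard : Fintype.card (ZMod n) < Fintype.card (Fin (s + 1) × Fin (s + 1)) := by
    simpa only [ZMod.card, Fintype.card_prod, Fintype.card_fin] using Nat.lt_succ_sqrt n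
  obtain ⟨⟨u₁, u₂⟩, ⟨v₁, v₂⟩, hne, hf⟩ := Fintype.exists_ne_map_eq_of_card_lt f hcard
  have hsqrt : s ^ 2 < n := (Nat.sqrt_le' n).lt_of_ne fun h => hn ⟨s, by rw [← h, pow_two]⟩
  have hsmall (a b : Fin (s + 1)) : ((a : ℤ) - (b : ℤ)) ^ 2 < n :=
    calc ((a : ℤ) - (b : ℤ)) ^ 2 ≤ (s : ℤ) ^ 2 := sq_le_sq' (by omega) (by omega)
      _ < n := mod_cast hsqrt
  refine ⟨u₁ - v₁, u₂ - v₂, ?_, hsmall u₁ v₁, hsmall u₂ v₂, ?_⟩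
  · contrapose! hne
    exact Prod.ext (Fin.ext (by simpa [sub_eq_zero] using hne.1))
      (Fin.ext (by simpa [sub_eq_zero] using hne.2))
  · simp only [f] at hf
    push_cast
    linear_combination hf

theorem exists_mul_eq_mul_sq_add_mul_sq {n : ℕ} (hn : ¬ IsSquare n) {a b : ℤ} (ha : 0 < a)
    (hb : 0 < b) {l : ZMod n} (hl : a * l ^ 2 + b = 0) :
    ∃ m x y : ℤ, 0 < m ∧ m < a + b ∧ m * n = a * x ^ 2 + b * y ^ 2 := by
  obtain ⟨x, y, hne, hx, hy, hxy⟩ := exists_intCast_eq_mul_intCast hn l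
  obtain ⟨m, hm⟩ : (n : ℤ) ∣ a * x ^ 2 + b * y ^ 2 := by
    rw [← ZMod.intCast_zmod_eq_zero_iff_dvd]
    push_cast
    rw [hxy]
    linear_combination (y : ZMod n) ^ 2 * hl
  have hpos : 0 < a * x ^ 2 + b * y ^ 2 := by
    rcases hne with h | h <;> positivity
  have hlt : a * x ^ 2 + b * y ^ 2 < n * (a + b) := by nlinarith
  rw [hm] at hpos hlt
  have hn₀ : (0 : ℤ) ≤ n := n.cast_nonneg
  exact ⟨m, x, y, pos_of_mul_pos_right hpos hn₀, lt_of_mul_lt_mul_left hlt hn₀, by rw [hm]; ring⟩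

theorem exists_mul_eq_mul_sq_add_prime_mul_sq {p q : ℕ} [Fact p.Prime] [Fact q.Prime] (hp : p ≠ 2)
    (hq : q % 4 = 3) (hne : p ≠ q) (hpq : IsSquare (p : ZMod q)) {a : ℤ} (ha : 0 < a)
    (hap₀ : (a : ZMod p) ≠ 0) (hap : IsSquare (a : ZMod p)) (haq : IsSquare (a : ZMod q)) :
    ∃ m x y : ℤ, 0 < m ∧ m < a + q ∧ IsSquare (m : ZMod q) ∧ m * p = a * x ^ 2 + q * y ^ 2 := by
  obtain ⟨k, hk⟩ := isSquare_neg_natCast_of_isSquare_natCast hp hq hpq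
  obtain ⟨j, hj⟩ := hap
  have hj₀ : j ≠ 0 := by rintro rfl; simp [hj] at hap₀
  have hroot : (a : ZMod p) * (k / j) ^ 2 + (q : ℤ) = 0 := by
    rw [hj]
    field_simp
    push_cast
    linear_combination -hk
  obtain ⟨m, x, y, hm₀, hmlt, hm⟩ := exists_mul_eq_mul_sq_add_mul_sq
    (Fact.out : p.Prime).prime.not_isSquare ha
    (mod_cast (Fact.out : q.Prime).pos) hroot
  refine ⟨m, x, y, hm₀, hmlt, ?_, hm⟩
  have hmp : (m : ZMod q) * p = a * x ^ 2 := by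
    have := congrArg (Int.cast : ℤ → ZMod q) hm
    push_cast at this
    rwa [ZMod.natCast_self, zero_mul, add_zero] at this
  exact isSquare_of_isSquare_mul_right (ZMod.prime_ne_zero q p hne.symm) hpq
    (hmp ▸ haq.mul (IsSquare.sq _))

theorem isSquare_zmod_seven_of_mod {n : ℕ} (hn : n % 7 = 1 ∨ n % 7 = 2 ∨ n % 7 = 4) :
    IsSquare (n : ZMod 7) := by
  rw [← ZMod.natCast_mod]
  rcases hn with hn | hn | hn <;> rw [hn] <;> decide

theorem eq_of_isSquare_zmod_seven {m : ℤ} (hpos : 0 < m) (hlt : m < 9)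
    (h : IsSquare (m : ZMod 7)) : m = 1 ∨ m = 2 ∨ m = 4 ∨ m = 7 ∨ m = 8 := by
  interval_cases m <;> revert h <;> decide

theorem even_and_even_of_sq_add_seven_mul_sq {x y : ℤ} (heven : Even (x ^ 2 + 7 * y ^ 2))
    (hdvd : ¬ 8 ∣ x ^ 2 + 7 * y ^ 2) : Even x ∧ Even y := by
  have hx := sq_emod_eight_of_odd (x := x)
  have hy := sq_emod_eight_of_odd (x := y)
  rw [odd_iff_sq_emod_two] at hx hy
  rw [Int.even_iff] at heven
  rw [even_iff_sq_emod_two, even_iff_sq_emod_two]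
  omega

theorem isRepresentedBy_seven {p : ℕ} [Fact p.Prime] (hp : p ≠ 2) (hp7 : IsSquare (p : ZMod 7)) :
    IsRepresentedBy 7 p := by
  rcases eq_or_ne p 7 with rfl | hne
  · exact ⟨0, 1, by norm_num⟩
  have : Fact (Nat.Prime 7) := ⟨by norm_num⟩
  obtain ⟨m, x, y, hm₀, hm8, hm, hxy⟩ := exists_mul_eq_mul_sq_add_prime_mul_sq hp (by norm_num)
    hne hp7 one_pos (by simp) (by simp) (by simp)
  have hodd : (p : ℤ) % 2 = 1 := by
    exact_mod_cast (Fact.out : p.Prime).mod_two_eq_one_iff_ne_two.mpr hp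
  push_cast at hm8 hxy
  rw [one_mul] at hxy
  rcases eq_of_isSquare_zmod_seven hm₀ (by omega) hm with rfl | rfl | rfl | rfl | rfl
  · exact ⟨x, y, by linarith⟩
  · obtain ⟨⟨z, rfl⟩, ⟨w, rfl⟩⟩ : Even x ∧ Even y :=
      even_and_even_of_sq_add_seven_mul_sq (by grind) (by omega)
    grind
  · obtain ⟨⟨z, rfl⟩, ⟨w, rfl⟩⟩ : Even x ∧ Even y :=
      even_and_even_of_sq_add_seven_mul_sq (by grind) (by omega)
    exact ⟨z, w, by linarith⟩
  · obtain ⟨z, rfl⟩ : 7 ∣ x :=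
      (show Prime (7 : ℤ) by norm_num).dvd_of_dvd_pow (n := 2) (by omega)
    exact ⟨y, z, by linarith⟩
  · omega

theorem isRepresentedBy_oneHundredTwelve {n : ℤ} (hn : n % 8 = 1) (h : IsRepresentedBy 7 n) :
    IsRepresentedBy 112 n := by
  obtain ⟨a, b, rfl⟩ := h
  have ha : a ^ 2 % 8 = 1 := sq_emod_eight_of_odd <| by
    have ha := sq_emod_four_of_even (x := a)
    have hb := sq_emod_eight_of_odd (x := b)
    rw [even_iff_sq_emod_two] at ha
    rw [odd_iff_sq_emod_two] at hb ⊢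
    omega
  obtain ⟨b', rfl⟩ := (even_iff_sq_emod_two (x := b)).mpr (by omega) |>.two_dvd
  rw [mul_pow] at hn
  obtain ⟨c, rfl⟩ := (even_iff_sq_emod_two (x := b')).mpr (by omega)
  exact ⟨a, c, by ring⟩

theorem isRepresentedBy_fourteen_of_two_mul_eq {n x y : ℤ} (h : 2 * n = 2 * x ^ 2 + 7 * y ^ 2) :
    IsRepresentedBy 14 n := by
  obtain ⟨w, rfl⟩ := even_iff_sq_emod_two (x := y) |>.mpr (by omega)
  exact ⟨x, w, by linarith⟩

theorem exists_eq_of_four_mul_eq {n x y : ℤ} (h : 4 * n = 2 * x ^ 2 + 7 * y ^ 2) :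
    ∃ z w : ℤ, n = 2 * z ^ 2 + 7 * w ^ 2 := by
  have hy : Even y := even_iff_sq_emod_two.mpr (by omega)
  have hy4 := sq_emod_four_of_even hy
  obtain ⟨z, rfl⟩ : Even x := even_iff_sq_emod_two.mpr (by omega)
  obtain ⟨w, rfl⟩ := hy
  exact ⟨z, w, by linarith⟩

theorem isRepresentedBy_fourteen_or {p : ℕ} [Fact p.Prime] (hp8 : p % 8 = 1 ∨ p % 8 = 7)
    (hp7 : IsSquare (p : ZMod 7)) :
    IsRepresentedBy 14 p ∨ ∃ x y : ℤ, (p : ℤ) = 2 * x ^ 2 + 7 * y ^ 2 := by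
  rcases eq_or_ne p 7 with rfl | hne
  · exact Or.inr ⟨0, 1, by norm_num⟩
  have : Fact (Nat.Prime 7) := ⟨by norm_num⟩
  have hp2 : p ≠ 2 := by omega
  have h2₀ : ((2 : ℤ) : ZMod p) ≠ 0 := by
    simpa using ZMod.prime_ne_zero p 2 hp2
  have h2 : IsSquare ((2 : ℤ) : ZMod p) := by
    simpa using (ZMod.exists_sq_eq_two_iff hp2).mpr hp8
  obtain ⟨m, x, y, hm₀, hm9, hm, hxy⟩ := exists_mul_eq_mul_sq_add_prime_mul_sq hp2 (by norm_num)
    hne hp7 two_pos h2₀ h2 ⟨3, rfl⟩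
  push_cast at hm9 hxy
  rcases eq_of_isSquare_zmod_seven hm₀ (by omega) hm with rfl | rfl | rfl | rfl | rfl
  · exact Or.inr ⟨x, y, by linarith⟩
  · exact Or.inl (isRepresentedBy_fourteen_of_two_mul_eq hxy)
  · exact Or.inr (exists_eq_of_four_mul_eq hxy)
  · obtain ⟨z, rfl⟩ : 7 ∣ x :=
      (show Prime (7 : ℤ) by norm_num).dvd_of_dvd_pow (n := 2) (by omega)
    exact Or.inl ⟨y, z, by linarith⟩
  · obtain ⟨z, w, hzw⟩ := exists_eq_of_four_mul_eq (n := 2 * p) (x := x) (y := y) (by linarith)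
    exact Or.inl (isRepresentedBy_fourteen_of_two_mul_eq hzw)

theorem isRepresentedBy_fiftySix_of_fourteen {n : ℤ} (hn : n % 8 = 1)
    (h : IsRepresentedBy 14 n) : IsRepresentedBy 56 n := by
  obtain ⟨x, y, rfl⟩ := h
  have hx : Odd x := odd_iff_sq_emod_two.mpr (by omega)
  have := sq_emod_eight_of_odd hx
  obtain ⟨w, rfl⟩ := even_iff_sq_emod_two (x := y) |>.mpr (by omega)
  exact ⟨x, w, by ring⟩

end Representations

section Parity

theorem emod_eight_iff_even_of_mul_eq_two_mul_sq_sub_sq {k o c y : ℤ} (ho : Odd o)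
    (h : k * o = 2 * c ^ 2 - y ^ 2)
    (hprim : ∀ d : ℤ, d ∣ k → d ∣ o → d ∣ y → IsUnit d) :
    (o + 2 * k) % 8 = 1 ∨ (o + 2 * k) % 8 = 7 ↔ Even c := by
  have ho8 : o % 8 = 1 ∨ o % 8 = 7 :=
    emod_eight_of_mul_eq_sq_sub_two_mul_sq (m := -k) (r := y) (s := c) ho
      (by linear_combination -h) fun d hdo hdk hdy _ => hprim d (dvd_neg.mp hdk) hdo hdy
  rcases Int.even_or_odd k with hk | hk
  · obtain ⟨l, rfl⟩ := hk.two_dvd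
    rw [mul_assoc] at h
    obtain ⟨w, rfl⟩ : Even y := even_iff_sq_emod_two.mpr (by omega)
    have hl : Even l ↔ Even c := by
      have hlo : l * o = c ^ 2 - 2 * w ^ 2 := by linarith
      have : Even (l * o) ↔ Even l := by
        simp [Int.even_mul, Int.not_even_iff_odd.mpr ho]
      rw [← this, Int.even_iff, even_iff_sq_emod_two]
      omega
    rw [← hl, Int.even_iff]
    omega
  · have hk8 : k % 8 = 1 ∨ k % 8 = 7 :=
      emod_eight_of_mul_eq_sq_sub_two_mul_sq (m := -o) (r := y) (s := c) hk
        (by linear_combination -h) fun d hdk hdo hdy _ => hprim d hdk (dvd_neg.mp hdo) hdy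
    have hy8 : y ^ 2 % 8 = 1 := sq_emod_eight_of_odd <| by
      have := Int.odd_iff.mp (hk.mul ho)
      rw [odd_iff_sq_emod_two]
      omega
    have hko8 : (k * o) % 8 = k % 8 * (o % 8) % 8 := Int.mul_emod k o 8
    have hc8 : Even c ↔ (k * o) % 8 = 7 := by
      rcases Int.even_or_odd c with hc | hc
      · have := sq_emod_four_of_even hc
        exact iff_of_true hc (by omega)
      · have := sq_emod_eight_of_odd hc
        exact iff_of_false (Int.not_even_iff_odd.mpr hc) (by omega)
    rw [hc8]
    rcases ho8 with ho8 | ho8 <;> rcases hk8 with hk8 | hk8 <;> rw [hk8, ho8] at hko8 <;> omega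

theorem even_iff_of_eq_sq_add_mul_sq_of_eq_sq_sub_mul_sq {n s t y c : ℤ} (hn : Squarefree n)
    (hodd : Odd n) (hy : n = (s + 7 * t) ^ 2 + 56 * y ^ 2)
    (hc : n = (s - 7 * t) ^ 2 + 112 * c ^ 2) : Even c ↔ n % 16 = 1 := by
  have hst : s * t = 2 * (2 * c ^ 2 - y ^ 2) := by linarith
  have hprim (d : ℤ) (hds : d ∣ s) (hdt : d ∣ t) (hdy : d ∣ y) : IsUnit d :=
    isUnit_of_dvd_of_squarefree_eq (a := 1) hn (by rw [hy, one_mul])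
      (dvd_add hds (hdt.mul_left 7)) hdy
  have hn16 : n % 16 = 1 ↔ (s - 7 * t) % 8 = 1 ∨ (s - 7 * t) % 8 = 7 := by
    rw [← sq_emod_sixteen_eq_one_iff, hc]
    omega
  have hparity : (s + 7 * t) % 2 = 1 := by
    have := Int.odd_iff.mp hodd
    rw [← Int.odd_iff, odd_iff_sq_emod_two]
    omega
  rw [hn16]
  rcases Int.even_or_odd s with ⟨k, rfl⟩ | hs
  · rw [← emod_eight_iff_even_of_mul_eq_two_mul_sq_sub_sq (k := k) (o := t) (y := y)
      (Int.odd_iff.mpr (by omega)) (by linarith) fun d hdk hdt => hprim d (dvd_add hdk hdk) hdt]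
    omega
  · obtain ⟨k, rfl⟩ : Even t := Int.even_iff.mpr (by have := Int.odd_iff.mp hs; omega)
    rw [← emod_eight_iff_even_of_mul_eq_two_mul_sq_sub_sq (k := k) (o := s) (y := y) hs
      (by linarith) fun d hdk hds => hprim d hds (dvd_add hdk hdk)]
    omega

theorem even_iff_of_eq_sq_add_fiftySix_mul_sq {n x y a c : ℤ} (hn : Squarefree n) (hodd : Odd n)
    (hxy : n = x ^ 2 + 56 * y ^ 2) (hac : n = a ^ 2 + 112 * c ^ 2) : Even c ↔ n % 16 = 1 := by
  have hparity : Even (x - a) := by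
    rw [Int.even_sub, even_iff_sq_emod_two, even_iff_sq_emod_two]
    omega
  obtain ⟨s, t, rfl, ha⟩ := exists_eq_add_mul_and_sq_eq (q := 7) (by norm_num) (by decide) hparity
    ⟨8 * (2 * c ^ 2 - y ^ 2), by linear_combination hac - hxy⟩
  exact even_iff_of_eq_sq_add_mul_sq_of_eq_sq_sub_mul_sq hn hodd hxy (ha ▸ hac)

theorem odd_iff_of_eq_two_mul_sq_add_seven_mul_sq {n x y a c : ℤ} (hn : Squarefree n)
    (hodd : Odd n) (hn7 : ¬ 7 ∣ n) (hxy : n = 2 * x ^ 2 + 7 * y ^ 2)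
    (hac : n = a ^ 2 + 112 * c ^ 2) : Odd c ↔ n % 16 = 1 := by
  rw [Int.odd_iff] at hodd
  have ha8 : a ^ 2 % 8 = 1 := sq_emod_eight_of_odd (odd_iff_sq_emod_two.mpr (by omega))
  have hy : Odd y := odd_iff_sq_emod_two.mpr (by omega)
  have hy8 : y ^ 2 % 8 = 1 := sq_emod_eight_of_odd hy
  have hx8 : x ^ 2 % 8 = 1 := sq_emod_eight_of_odd (odd_iff_sq_emod_two.mpr (by omega))
  have hsub : Odd (y - 4 * c) := hy.sub_even (Even.mul_right (by decide) c)
  have hdiff : (y - 4 * c) % 8 = 1 ∨ (y - 4 * c) % 8 = 7 := by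
    refine emod_eight_of_mul_eq_sq_sub_two_mul_sq (m := 7 * (y + 4 * c)) (r := a) (s := x)
      hsub (by linear_combination hac - hxy) fun k hk hk' _ hkx => ?_
    have hk2 : IsCoprime k 2 :=
      (Int.isCoprime_two_right.mpr hsub).of_isCoprime_of_dvd_left hk
    have hk7 : IsCoprime k 7 := by
      refine ((Prime.coprime_iff_not_dvd (by norm_num)).mpr fun h7k => hn7 ?_).symm
      rw [hxy]
      exact dvd_add (((h7k.trans hkx).pow two_ne_zero).mul_left 2) (dvd_mul_right 7 _)
    have hky : k ∣ 2 * (7 * y) := by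
      rw [show 2 * (7 * y) = 7 * (y - 4 * c) + 7 * (y + 4 * c) by ring]
      exact dvd_add (hk.mul_left 7) hk'
    exact isUnit_of_dvd_of_squarefree_eq hn hxy hkx
      (hk7.dvd_of_dvd_mul_left (hk2.dvd_of_dvd_mul_left hky))
  have hy16 := sq_emod_sixteen_eq_one_iff (x := y)
  rw [Int.odd_iff]
  omega

end Parity

section Criterion

variable {p : ℕ} [Fact p.Prime]

theorem isRepresentedBy_fiftySix_iff (hp8 : p % 8 = 1) (hp7 : IsSquare (p : ZMod 7)) {a c : ℤ}
    (hac : (p : ℤ) = a ^ 2 + 112 * c ^ 2) :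
    IsRepresentedBy 56 p ↔ (Even c ↔ p % 16 = 1) := by
  have hp : p.Prime := Fact.out
  have hsq : Squarefree (p : ℤ) := Int.squarefree_natCast.mpr hp.prime.squarefree
  have hodd : Odd (p : ℤ) := by grind
  have hp16 : p % 16 = 1 ↔ (p : ℤ) % 16 = 1 := by omega
  rw [hp16]
  refine ⟨fun ⟨x, y, hxy⟩ => even_iff_of_eq_sq_add_fiftySix_mul_sq hsq hodd hxy hac, fun hc => ?_⟩
  rcases isRepresentedBy_fourteen_or (Or.inl hp8) hp7 with h | ⟨x, y, hxy⟩
  · exact isRepresentedBy_fiftySix_of_fourteen (by omega) h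
  · have h7 : ¬ 7 ∣ p := by
      rw [Nat.prime_dvd_prime_iff_eq (by norm_num) hp]
      omega
    have := odd_iff_of_eq_two_mul_sq_add_seven_mul_sq hsq hodd (mod_cast h7) hxy hac
    grind

theorem isRepresentedBy_fiftySix_iff_isRepresentedBy_iff (hp8 : p % 8 = 1)
    (hp7 : IsSquare (p : ZMod 7)) :
    (IsRepresentedBy 56 p ↔ IsRepresentedBy 448 p) ↔ p % 16 = 1 := by
  by_cases h448 : IsRepresentedBy 448 p
  · have ⟨a, b, hab⟩ := h448
    rw [iff_true_right h448,
      isRepresentedBy_fiftySix_iff hp8 hp7 (a := a) (c := 2 * b) (by linarith)]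
    simp
  · obtain ⟨a, c, hac⟩ := isRepresentedBy_oneHundredTwelve (n := p) (by omega)
      (isRepresentedBy_seven (by omega) hp7)
    have hc : ¬ Even c := by
      rintro ⟨b, rfl⟩
      exact h448 ⟨a, b, by linarith⟩
    rw [iff_false_right h448, isRepresentedBy_fiftySix_iff hp8 hp7 hac]
    tauto

end Criterion

theorem mainTheorem2 (p : ℕ) (hp : p.Prime) :
    ((p ≡ 1 [MOD 112] ∨ p ≡ 65 [MOD 112] ∨ p ≡ 81 [MOD 112]) →
      (IsRepresentedBy 56 (p : ℤ) ↔ IsRepresentedBy 448 (p : ℤ))) ∧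
    ((p ≡ 9 [MOD 112] ∨ p ≡ 25 [MOD 112] ∨ p ≡ 57 [MOD 112]) →
      ((IsRepresentedBy 56 (p : ℤ) ∧ ¬ IsRepresentedBy 448 (p : ℤ)) ∨
        (IsRepresentedBy 448 (p : ℤ) ∧ ¬ IsRepresentedBy 56 (p : ℤ)))) := by
  have : Fact p.Prime := ⟨hp⟩
  have hiff (hp8 : p % 8 = 1) (hp7 : p % 7 = 1 ∨ p % 7 = 2 ∨ p % 7 = 4) :=
    isRepresentedBy_fiftySix_iff_isRepresentedBy_iff hp8 (isSquare_zmod_seven_of_mod hp7)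
  simp only [Nat.ModEq]
  refine ⟨fun h => (hiff (by omega) (by omega)).mpr (by omega), fun h => ?_⟩
  have := (hiff (by omega) (by omega)).not.mpr (by omega)
  tauto
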